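/- Let $\Gamma$ be a discrete group and let $C^*_r(\Gamma)\subset B(\ell^2(\Gamma))$ be its reduced group C$^*$-algebra. There exist a unital C$^*$-algebra $A$ which has the weak expectation property (WEP) and at least one tracial state, and a unital $*$-homomorphism $\pi : C^*_r(\Gamma)\to A$, if and only if $\Gamma$ is amenable. The same equivalence holds if $A$ is in addition required to be separable. Here $A$ has the WEP if for every faithful unital representation $\rho : A\to B(H)$ on a Hilbert space $H$ there is a unital completely positive map $\Phi : B(H)\to \rho(A)''$ such that $\Phi(\rho(a))=\rho(a)$ for all $a\in A$. -/

import Mathlib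

open scoped ENNReal ComplexOrder CStarAlgebra

universe u v

/-! ### Left translation on `ℓᵖ(Γ)` and amenability -/

section LeftTranslation

variable {Γ : Type u} [Group Γ] {F : Type*} [NormedAddCommGroup F]

theorem memℓp_leftTranslate {p : ℝ≥0∞} (g : Γ) {f : Γ → F}
    (hf : Memℓp (E := fun _ : Γ => F) f p) :
    Memℓp (E := fun _ : Γ => F) (fun x => f (g⁻¹ * x)) p := by
  rcases p.trichotomy with rfl | rfl | hp
  · refine memℓp_zero ?_
    exact (memℓp_zero_iff.1 hf).preimage (mul_right_injective g⁻¹).injOn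
  · refine memℓp_infty ((memℓp_infty_iff.1 hf).mono ?_)
    rintro _ ⟨x, rfl⟩
    exact ⟨g⁻¹ * x, rfl⟩
  · exact memℓp_gen ((Equiv.mulLeft g⁻¹).summable_iff.2 ((memℓp_gen_iff hp).1 hf))

/-- The left translate `x ↦ f (g⁻¹ x)` of a function `f ∈ ℓᵖ(Γ)`. -/
def leftTranslate {p : ℝ≥0∞} (g : Γ) (f : lp (fun _ : Γ => F) p) : lp (fun _ : Γ => F) p :=
  ⟨fun x => f (g⁻¹ * x), memℓp_leftTranslate g (lp.memℓp f)⟩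

@[simp]
theorem leftTranslate_apply {p : ℝ≥0∞} (g : Γ) (f : lp (fun _ : Γ => F) p) (x : Γ) :
    leftTranslate g f x = f (g⁻¹ * x) := rfl

end LeftTranslation

/-- A discrete group `Γ` is amenable if there is a left-invariant mean on `ℓ^∞(Γ)`. -/
def IsAmenableGroup (Γ : Type u) [Group Γ] : Prop :=
  ∃ m : lp (fun _ : Γ => ℝ) ∞ →ₗ[ℝ] ℝ,
    (∀ f : lp (fun _ : Γ => ℝ) ∞, (∀ x, 0 ≤ f x) → 0 ≤ m f) ∧
    m 1 = 1 ∧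
    ∀ (g : Γ) (f : lp (fun _ : Γ => ℝ) ∞), m (leftTranslate g f) = m f

/-! ### The reduced group C⋆-algebra -/

noncomputable section ReducedGroupCStarAlgebra

variable (Γ : Type u) [Group Γ]

/-- The left regular representation `λ_g` of `Γ` on `ℓ²(Γ)`, `(λ_g f)(x) = f (g⁻¹ x)`, as an
isometry. -/
def leftRegularIsometry (g : Γ) :
    lp (fun _ : Γ => ℂ) 2 →ₗᵢ[ℂ] lp (fun _ : Γ => ℂ) 2 where
  toFun := leftTranslate g
  map_add' _ _ := rfl
  map_smul' _ _ := rfl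
  norm_map' f := by
    have h2 : 0 < (2 : ℝ≥0∞).toReal := by norm_num
    change ‖leftTranslate g f‖ = ‖f‖
    rw [lp.norm_eq_tsum_rpow h2, lp.norm_eq_tsum_rpow h2]
    congr 1
    exact (Equiv.mulLeft g⁻¹).tsum_eq (fun x => ‖f x‖ ^ (2 : ℝ≥0∞).toReal)

/-- The operator `λ_g ∈ B(ℓ²(Γ))`. -/
def leftRegular (g : Γ) : lp (fun _ : Γ => ℂ) 2 →L[ℂ] lp (fun _ : Γ => ℂ) 2 :=
  (leftRegularIsometry Γ g).toContinuousLinearMap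

/-- The reduced group C⋆-algebra `C*_r(Γ)`: the norm-closed unital ⋆-subalgebra of `B(ℓ²(Γ))`
generated by the operators `λ_g`, `g ∈ Γ`. -/
def reducedGroupCStarAlgebra :
    StarSubalgebra ℂ (lp (fun _ : Γ => ℂ) 2 →L[ℂ] lp (fun _ : Γ => ℂ) 2) :=
  (StarAlgebra.adjoin ℂ (Set.range (leftRegular Γ))).topologicalClosure

end ReducedGroupCStarAlgebra

/-! ### Tracial states and the weak expectation property -/

/-- A tracial state: a positive, unital linear functional with `τ (a * b) = τ (b * a)`. -/
structure IsTracialState {A : Type v} [CStarAlgebra A] (τ : A →ₗ[ℂ] ℂ) : Prop where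
  nonneg : ∀ a : A, 0 ≤ τ (star a * a)
  map_one : τ 1 = 1
  map_mul_comm : ∀ a b : A, τ (a * b) = τ (b * a)

/-- The weak expectation property: for every faithful representation `π : A → B(H)` there is a
unital completely positive map `Φ : B(H) → π(A)''` with `Φ (π a) = π a` for all `a`. -/
def HasWEP (A : Type v) [CStarAlgebra A] : Prop :=
  ∀ (H : Type v) [NormedAddCommGroup H] [InnerProductSpace ℂ H] [CompleteSpace H]
    (π : A →⋆ₐ[ℂ] (H →L[ℂ] H)), Function.Injective π →
    ∃ Φ : (H →L[ℂ] H) →CP (H →L[ℂ] H),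
      (∀ T, Φ T ∈ Set.centralizer (Set.centralizer (Set.range π))) ∧
      Φ 1 = 1 ∧
      ∀ a : A, Φ (π a) = π a

/-! ### Extending isometries and forming direct sums of representations -/

/-! If `Γ` is amenable, almost invariant unit vectors in `ℓ²(Γ)` have an ultralimit state `χ` on
`B(ℓ²(Γ))` with `χ(λ_g) = 1` for all `g`. By Cauchy–Schwarz every `λ_g` lies in the multiplicative
domain of `χ`, so `χ` restricts to a character of `C*_r(Γ)`. Hence `A = ℂ` works, and it is
separable (`IsAmenableGroup.exists_character`, `hasWEP_punit`).

Conversely, let `A` have the WEP and a tracial state `τ`, and let `j : C*_r(Γ) → A`. Represent `A`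
faithfully by its universal representation, with `Φ` the weak expectation and `ξ` the GNS vector of
`τ`. Then `ψ(T) = ⟪ξ, Φ(T) ξ⟫` is invariant under conjugation by unitaries of `A`. Indeed `Φ` is an
`A`-bimodule map, and by traciality `u* ξ = W ξ` for some `W` in the commutant that is isometric on
the summand of `τ`; `W` commutes with `Φ(T)` (`HasWEP.exists_hypertrace`).

The representation of `C*_r(Γ)` through `j` extends to a positive unital `C*_r(Γ)`-bimodule map `θ`
on `B(ℓ²(Γ))`: extend the functionals of cyclic vectors, take GNS representations, sum them and
compress (`StarSubalgebra.exists_positive_bimodule_extension`). Since `λ_g M_f λ_g*` is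
multiplication by the translate of `f`, the mean `f ↦ Re ψ(θ(M_f))` is left invariant
(`isAmenableGroup_of_hasWEP`). -/

theorem exists_linearIsometry_of_denseRange {X H K : Type*} [AddCommGroup X] [Module ℂ X]
    [NormedAddCommGroup H] [InnerProductSpace ℂ H] [NormedAddCommGroup K] [InnerProductSpace ℂ K]
    [CompleteSpace K] (e : X →ₗ[ℂ] H) (f : X →ₗ[ℂ] K) (he : DenseRange e)
    (hef : ∀ x, ‖f x‖ = ‖e x‖) : ∃ V : H →ₗᵢ[ℂ] K, ∀ x, V (e x) = f x := by
  have hb : ∃ C, ∀ x, ‖f x‖ ≤ C * ‖e x‖ := ⟨1, fun x => by rw [one_mul, hef]⟩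
  have hV : ∀ x, f.extendOfNorm e (e x) = f x := LinearMap.extendOfNorm_eq he hb
  refine ⟨⟨(f.extendOfNorm e).toLinearMap, fun x => ?_⟩, hV⟩
  refine he.induction (P := fun x => ‖f.extendOfNorm e x‖ = ‖x‖) ?_ ?_ x
  · rintro _ ⟨y, rfl⟩
    rw [hV, hef]
  · exact isClosed_eq (by fun_prop) (by fun_prop)

section DirectSum

variable {ι : Type*} {G : ι → Type*} [∀ i, NormedAddCommGroup (G i)]
  [∀ i, InnerProductSpace ℂ (G i)] [∀ i, CompleteSpace (G i)]
  {A : Type*} [CStarAlgebra A]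

/-- The direct sum of a family of representations of a C⋆-algebra. -/
noncomputable def directSumRep (ρ : ∀ i, A →⋆ₐ[ℂ] (G i →L[ℂ] G i)) :
    A →⋆ₐ[ℂ] (lp G 2 →L[ℂ] lp G 2) where
  toFun a := lp.mapCLM 2 (fun i => ρ i a) (norm_nonneg a)
    fun i => NonUnitalStarAlgHom.norm_apply_le (ρ i) a
  map_one' := by ext; simp
  map_mul' a b := by ext; simp
  map_zero' := by ext; simp
  map_add' a b := by ext; simp
  commutes' r := by
    ext
    simp [Algebra.algebraMap_eq_smul_one]
  map_star' a := by
    rw [ContinuousLinearMap.star_eq_adjoint, ContinuousLinearMap.eq_adjoint_iff]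
    intro x y
    rw [lp.inner_eq_tsum, lp.inner_eq_tsum]
    refine tsum_congr fun i => ?_
    simp [map_star, ContinuousLinearMap.star_eq_adjoint, ContinuousLinearMap.adjoint_inner_left]

@[simp]
theorem directSumRep_apply (ρ : ∀ i, A →⋆ₐ[ℂ] (G i →L[ℂ] G i)) (a : A) (x : lp G 2) (i : ι) :
    directSumRep ρ a x i = ρ i a (x i) := rfl

theorem directSumRep_single [DecidableEq ι] (ρ : ∀ i, A →⋆ₐ[ℂ] (G i →L[ℂ] G i)) (a : A) (i : ι)
    (x : G i) : directSumRep ρ a (lp.single 2 i x) = lp.single 2 i (ρ i a x) := by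
  ext j
  rw [directSumRep_apply]
  by_cases h : j = i
  · subst h
    simp
  · simp [h]

end DirectSum

/-! ### Positive functionals -/

section PositiveFunctional

variable {B : Type*} [CStarAlgebra B] [PartialOrder B] [StarOrderedRing B]

/-- The complexification of a real functional that is nonnegative on the elements with
nonnegative real part. -/
theorem exists_positiveLinearMap_of_real (g : B →ₗ[ℝ] ℝ) (hg : ∀ x, 0 ≤ x + star x → 0 ≤ g x) :
    ∃ φ : B →ₚ[ℂ] ℂ, ∀ x, φ x = g x - Complex.I * g (Complex.I • x) := by
  refine ⟨PositiveLinearMap.mk₀ (Module.Dual.extendRCLike (𝕜 := ℂ) g) fun x hx => ?_, fun x => rfl⟩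
  have hx' : star x = x := (IsSelfAdjoint.of_nonneg hx).star_eq
  have h1 : 0 ≤ g x := hg x (by rw [hx']; exact add_nonneg hx hx)
  have h2 : 0 ≤ g (Complex.I • x) := hg _ (by simp [star_smul, hx'])
  have h3 : 0 ≤ g (-(Complex.I • x)) := hg _ (by simp [star_smul, hx'])
  rw [map_neg] at h3
  have h4 : g (Complex.I • x) = 0 := by linarith
  have : Module.Dual.extendRCLike (𝕜 := ℂ) g x = (g x : ℂ) := by
    simp [Module.Dual.extendRCLike_apply, h4]
  rw [this]
  exact_mod_cast h1

/-- Hahn–Banach separates `-(star a * a)` from the closed cone of elements with nonnegative real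
part; the negative of the separating functional is positive. -/
theorem exists_positiveLinearMap_star_mul_self_ne_zero {a : B} (ha : a ≠ 0) :
    ∃ φ : B →ₚ[ℂ] ℂ, φ (star a * a) ≠ 0 := by
  let C : Set B := {x | 0 ≤ x + star x}
  have hcl : IsClosed C := isClosed_le continuous_const (by fun_prop)
  have hcv : Convex ℝ C := by
    intro x hx y hy s t hs ht _
    have : s • x + t • y + star (s • x + t • y) = s • (x + star x) + t • (y + star y) := by
      simp [star_smul, smul_add]; abel
    change 0 ≤ _
    rw [this]
    exact add_nonneg (smul_nonneg hs hx) (smul_nonneg ht hy)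
  have hsa : 0 ≤ star a * a := star_mul_self_nonneg a
  have hnot : -(star a * a) ∉ C := by
    intro h
    have h' : 0 ≤ -(star a * a) + star (-(star a * a)) := h
    rw [star_neg, star_mul, star_star] at h'
    have h0 : star a * a + star a * a ≤ 0 := by
      rw [← neg_nonneg]; simpa [neg_add] using h'
    have h1 : star a * a = 0 := le_antisymm ((le_add_of_nonneg_left hsa).trans h0) hsa
    exact ha ((CStarRing.star_mul_self_eq_zero_iff a).1 h1)
  obtain ⟨f, u, hf, hu⟩ := geometric_hahn_banach_closed_point hcv hcl hnot
  have h0 : 0 < u := by simpa using hf 0 (by simp [C])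
  have hneg : ∀ x ∈ C, f x ≤ 0 := by
    intro x hx
    by_contra! hpos
    -- Were `f x > 0`, this rescaled point of the cone would have value exactly `u`, against `f < u`
    -- on the cone.
    have hmem : (u / f x) • x ∈ C := by
      have : (u / f x) • x + star ((u / f x) • x) = (u / f x) • (x + star x) := by
        simp [star_smul, smul_add]
      change 0 ≤ _
      rw [this]
      exact smul_nonneg (by positivity) hx
    have := hf _ hmem
    rw [map_smul, smul_eq_mul, div_mul_cancel₀ _ hpos.ne'] at this
    exact lt_irrefl _ this
  obtain ⟨φ, hφ⟩ := exists_positiveLinearMap_of_real (-f.toLinearMap)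
    fun x hx => by simpa using hneg x hx
  refine ⟨φ, fun h => ?_⟩
  have := congrArg Complex.re (hφ (star a * a))
  rw [h] at this
  simp at this hu
  linarith

/-- Positivity is measured in `B`, but the square root of `d` stays in the closed subalgebra `D`, so
`d = star s * s` already holds in `D`. -/
theorem StarSubalgebra.map_nonneg_of_isClosed {C : Type*} [CStarAlgebra C] [PartialOrder C]
    [StarOrderedRing C] (D : StarSubalgebra ℂ B) (hD : IsClosed (D : Set B)) (σ : D →⋆ₐ[ℂ] C)
    (d : D) (hd : 0 ≤ (d : B)) : 0 ≤ σ d := by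
  have hs : IsSelfAdjoint (d : B) := .of_nonneg hd
  have hmem : CFC.sqrt (d : B) ∈ D := by
    rw [CFC.sqrt_eq_real_sqrt (d : B)]
    exact cfcₙ_mem (𝕜' := ℂ) (hs := hD) _ d.2
  let s : D := ⟨CFC.sqrt (d : B), hmem⟩
  have hds : d = star s * s := by
    ext
    have : star (CFC.sqrt (d : B)) = CFC.sqrt (d : B) :=
      (IsSelfAdjoint.of_nonneg (CFC.sqrt_nonneg _)).star_eq
    simp [s, this, CFC.sqrt_mul_sqrt_self (d : B) hd]
  rw [hds, map_mul, map_star]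
  exact star_mul_self_nonneg _

/-- A vector functional of a representation of a closed unital ⋆-subalgebra extends to a positive
functional on the whole C⋆-algebra. -/
theorem StarSubalgebra.exists_extension_vector_functional {H : Type*} [NormedAddCommGroup H]
    [InnerProductSpace ℂ H] [CompleteSpace H] (D : StarSubalgebra ℂ B)
    (hD : IsClosed (D : Set B)) (σ : D →⋆ₐ[ℂ] (H →L[ℂ] H)) (x : H) :
    ∃ φ : B →ₚ[ℂ] ℂ, ∀ d : D, φ d = inner ℂ x (σ d x) := by
  -- The extension is M. Riesz's: the cone is that of nonnegative real part, and the functional on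
  -- `D` is the real part of the vector functional.
  let s : PointedCone ℝ B :=
    { carrier := {y | 0 ≤ y + star y}
      add_mem' := fun {y z} hy hz => by
        have : y + z + star (y + z) = (y + star y) + (z + star z) := by
          simp; abel
        change 0 ≤ _
        rw [this]
        exact add_nonneg hy hz
      zero_mem' := by simp
      smul_mem' := fun c y hy => by
        have : c • y + star (c • y) = (c : ℝ) • (y + star y) := by
          change (c : ℝ) • y + star ((c : ℝ) • y) = (c : ℝ) • (y + star y)
          rw [star_smul, star_trivial (c : ℝ), smul_add]
        change 0 ≤ _
        rw [this]
        exact smul_nonneg c.2 hy }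
  let f : B →ₗ.[ℝ] ℝ :=
    { domain := (Subalgebra.toSubmodule D.toSubalgebra).restrictScalars ℝ
      toFun :=
        { toFun := fun d => (inner ℂ x (σ ⟨d.1, d.2⟩ x)).re
          map_add' := fun a b => by
            have : (⟨(a + b).1, (a + b).2⟩ : D) = ⟨a.1, a.2⟩ + ⟨b.1, b.2⟩ := rfl
            rw [this, map_add]
            simp
          map_smul' := fun r a => by
            have : (⟨(r • a).1, (r • a).2⟩ : D) = (r : ℂ) • ⟨a.1, a.2⟩ := by
              ext; simp
            rw [this, map_smul]
            simp } }
  have hnonneg : ∀ d : f.domain, (d : B) ∈ s → 0 ≤ f d := by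
    intro d hd
    have h1 := D.map_nonneg_of_isClosed hD σ ((⟨d.1, d.2⟩ : D) + star (⟨d.1, d.2⟩ : D)) hd
    rw [ContinuousLinearMap.nonneg_iff_isPositive] at h1
    have h2 := h1.re_inner_nonneg_right x
    rw [map_add, map_star, add_apply, inner_add_right,
      ContinuousLinearMap.star_eq_adjoint, ContinuousLinearMap.adjoint_inner_right, map_add,
      ← inner_conj_symm (σ ⟨d.1, d.2⟩ x) x] at h2
    simp only [RCLike.re_to_complex, Complex.conj_re] at h2
    change 0 ≤ (inner ℂ x (σ ⟨d.1, d.2⟩ x)).re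
    linarith
  have hdense : ∀ y, ∃ d : f.domain, (d : B) + y ∈ s := by
    intro y
    -- The scalar `‖y + star y‖` lies in `D` and is large enough to push `y` into the cone.
    refine ⟨⟨algebraMap ℂ B ‖y + star y‖, D.algebraMap_mem _⟩, ?_⟩
    have h1 : IsSelfAdjoint (y + star y) := IsSelfAdjoint.add_star_self y
    have h2 := h1.neg_algebraMap_norm_le_self
    have h3 : algebraMap ℂ B ‖y + star y‖ = algebraMap ℝ B ‖y + star y‖ := by
      simp [Algebra.algebraMap_eq_smul_one]
    have h4 : 0 ≤ algebraMap ℝ B ‖y + star y‖ := by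
      rw [Algebra.algebraMap_eq_smul_one]
      exact smul_nonneg (norm_nonneg _) zero_le_one
    have h5 : star (algebraMap ℝ B ‖y + star y‖) = algebraMap ℝ B ‖y + star y‖ :=
      (IsSelfAdjoint.of_nonneg h4).star_eq
    change 0 ≤ algebraMap ℂ B ‖y + star y‖ + y + star (algebraMap ℂ B ‖y + star y‖ + y)
    rw [h3, star_add, h5]
    have h6 : algebraMap ℝ B ‖y + star y‖ + y + (algebraMap ℝ B ‖y + star y‖ + star y) =
      algebraMap ℝ B ‖y + star y‖ + (y + star y - -algebraMap ℝ B ‖y + star y‖) := by abel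
    rw [h6]
    exact add_nonneg h4 (sub_nonneg.2 h2)
  obtain ⟨g, hgf, hgs⟩ := riesz_extension s f hnonneg hdense
  obtain ⟨φ, hφ⟩ := exists_positiveLinearMap_of_real g hgs
  refine ⟨φ, fun d => ?_⟩
  have key : ∀ d : D, g d = (inner ℂ x (σ d x)).re := fun d => hgf ⟨d.1, d.2⟩
  rw [hφ, key d, show Complex.I • (d : B) = ((Complex.I • d : D) : B) from rfl, key, map_smul]
  apply Complex.ext <;> simp

end PositiveFunctional

/-! ### Extending a representation to a positive bimodule map -/

section Extension

variable {H : Type*} [NormedAddCommGroup H] [InnerProductSpace ℂ H] [CompleteSpace H]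

theorem inner_map_map_eq {D : Type*} [Semiring D] [StarRing D] [Algebra ℂ D]
    (σ : D →⋆ₐ[ℂ] (H →L[ℂ] H)) (a b : D) (x y : H) :
    inner ℂ (σ a x) (σ b y) = inner ℂ x (σ (star a * b) y) := by
  rw [map_mul, map_star, ContinuousLinearMap.star_eq_adjoint]
  exact (ContinuousLinearMap.adjoint_inner_right (σ a) x (σ b y)).symm

/-- Every representation is an orthogonal sum of cyclic ones: the finite sums `∑ σ (d s) s` over a
suitable set of vectors `s` with pairwise orthogonal orbits are dense. -/
theorem exists_cyclic_decomposition {D : Type*} [Ring D] [StarRing D] [Algebra ℂ D]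
    (σ : D →⋆ₐ[ℂ] (H →L[ℂ] H)) :
    ∃ (S : Set H) (e : (S →₀ D) →ₗ[ℂ] H), (∀ s d, e (Finsupp.single s d) = σ d s) ∧
      DenseRange e ∧ ∀ s t : S, s ≠ t → ∀ d, inner ℂ (s : H) (σ d t) = 0 := by
  obtain ⟨S, hS⟩ := zorn_subset {S : Set H | S.Pairwise fun s t => ∀ d, inner ℂ s (σ d t) = 0} (by
    intro c hc hchain
    refine ⟨⋃₀ c, ?_, fun s hs => Set.subset_sUnion_of_mem hs⟩
    exact (Set.pairwise_sUnion hchain.directedOn).2 fun s hs => hc hs)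
  let e : (S →₀ D) →ₗ[ℂ] H := Finsupp.lsum ℂ fun s : S =>
    { toFun := fun d => σ d s
      map_add' := fun a b => by simp
      map_smul' := fun r a => by simp }
  have he : ∀ s d, e (Finsupp.single s d) = σ d s := fun s d => by simp [e]
  refine ⟨S, e, he, ?_, fun s t hst d => hS.prop s.2 t.2 (fun h => hst (Subtype.ext h)) d⟩
  have hbot : (LinearMap.range e)ᗮ = ⊥ := by
    rw [Submodule.eq_bot_iff]
    intro x hx
    have horth : ∀ s ∈ S, ∀ d, inner ℂ x (σ d s) = 0 := fun s hs d => by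
      rw [← he ⟨s, hs⟩ d]
      exact (Submodule.mem_orthogonal' _ _).1 hx _ (LinearMap.mem_range_self e _)
    -- A vector `x` orthogonal to all orbits could be added to the maximal set `S`; so `x ∈ S`, and
    -- `x` is orthogonal to itself.
    have hins : insert x S ∈ {S : Set H | S.Pairwise fun s t => ∀ d, inner ℂ s (σ d t) = 0} := by
      refine (Set.pairwise_insert).2 ⟨hS.prop, fun s hs _ => ⟨horth s hs, fun d => ?_⟩⟩
      have h1 := horth s hs (star d)
      have h2 := inner_map_map_eq σ d 1 x s
      rw [mul_one, h1, map_one] at h2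
      exact inner_eq_zero_symm.1 (by simpa using h2)
    have hxS : x ∈ S := hS.le_of_ge hins (Set.subset_insert x S) (Set.mem_insert x S)
    simpa using horth x hxS 1
  have := Submodule.topologicalClosure_eq_top_iff.2 hbot
  exact Submodule.dense_iff_topologicalClosure_eq_top.2 this

/-- A representation of `D` is contained in a direct sum of representations that contain its
cyclic summands. -/
theorem exists_linearIsometry_intertwining_directSum {B : Type*} [CStarAlgebra B] {D : Type*} [Ring D] [StarRing D]
    [Algebra ℂ D] (σ : D →⋆ₐ[ℂ] (H →L[ℂ] H)) (S : Set H) (e : (S →₀ D) →ₗ[ℂ] H)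
    (he : ∀ s d, e (Finsupp.single s d) = σ d s) (hdense : DenseRange e)
    (horth : ∀ s t : S, s ≠ t → ∀ d, inner ℂ (s : H) (σ d t) = 0)
    {G : S → Type*} [∀ s, NormedAddCommGroup (G s)] [∀ s, InnerProductSpace ℂ (G s)]
    [∀ s, CompleteSpace (G s)] (ρ : ∀ s, B →⋆ₐ[ℂ] (G s →L[ℂ] G s)) (ι : D →ₗ[ℂ] B)
    (ζ : ∀ s, D →ₗ[ℂ] G s)
    (hζ : ∀ s a b, inner ℂ (ζ s a) (ζ s b) = inner ℂ (s : H) (σ (star a * b) s))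
    (hρ : ∀ s d a, ρ s (ι d) (ζ s a) = ζ s (d * a)) :
    ∃ V : H →ₗᵢ[ℂ] lp G 2, ∀ d x, V (σ d x) = directSumRep ρ (ι d) (V x) := by
  classical
  let f : (S →₀ D) →ₗ[ℂ] lp G 2 := Finsupp.lsum ℂ fun s : S =>
    { toFun := fun d => lp.single 2 s (ζ s d)
      map_add' := fun a b => by rw [map_add, lp.single_add]
      map_smul' := fun r a => by rw [map_smul, lp.single_smul, RingHom.id_apply] }
  have hf : ∀ s d, f (Finsupp.single s d) = lp.single 2 s (ζ s d) := fun s d => by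
    simp [f]
  have hinner : ∀ x y, inner ℂ (f x) (f y) = inner ℂ (e x) (e y) := by
    intro x y
    induction x using Finsupp.induction_linear with
    | zero => simp
    | add x x' hx hx' => rw [map_add, map_add, inner_add_left, inner_add_left, hx, hx']
    | single s a =>
      induction y using Finsupp.induction_linear with
      | zero => simp
      | add y y' hy hy' => rw [map_add, map_add, inner_add_right, inner_add_right, hy, hy']
      | single t b =>
        rw [hf, hf, he, he, inner_map_map_eq, lp.inner_single_left]
        by_cases h : s = t
        · subst h
          rw [lp.single_apply_self, hζ]
        · rw [horth s t h, lp.single_apply_ne _ _ _ h, inner_zero_right]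
  obtain ⟨V, hV⟩ := exists_linearIsometry_of_denseRange e f hdense fun x => by
    rw [@norm_eq_sqrt_re_inner ℂ, @norm_eq_sqrt_re_inner ℂ, hinner]
  refine ⟨V, fun d x => ?_⟩
  refine hdense.induction (P := fun x => V (σ d x) = directSumRep ρ (ι d) (V x)) ?_ ?_ x
  · rintro _ ⟨y, rfl⟩
    induction y using Finsupp.induction_linear with
    | zero => simp
    | add y y' hy hy' => simp only [map_add, hy, hy']
    | single s a =>
      have h1 : σ d (σ a s) = σ (d * a) s := by rw [map_mul]; rfl
      rw [hV, he, h1, ← he, hV, hf, hf, directSumRep_single, hρ]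
  · exact isClosed_eq (by fun_prop) (by fun_prop)

variable {B : Type*} [CStarAlgebra B] [PartialOrder B] [StarOrderedRing B]

namespace PositiveLinearMap

/-- The canonical map of a C⋆-algebra into the Hilbert space of the GNS construction. -/
noncomputable def gnsMap (φ : B →ₚ[ℂ] ℂ) : B →ₗ[ℂ] φ.GNS :=
  (UniformSpace.Completion.toComplₗᵢ (𝕜 := ℂ) (E := φ.PreGNS)).toLinearMap ∘ₗ
    φ.toPreGNS.toLinearMap

theorem gnsMap_eq (φ : B →ₚ[ℂ] ℂ) (a : B) : φ.gnsMap a = (φ.toPreGNS a : φ.GNS) := rfl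

theorem inner_gnsMap (φ : B →ₚ[ℂ] ℂ) (a b : B) :
    inner ℂ (φ.gnsMap a) (φ.gnsMap b) = φ (star a * b) := by
  rw [gnsMap_eq, gnsMap_eq, UniformSpace.Completion.inner_coe, preGNS_inner_def]
  simp

theorem gnsStarAlgHom_gnsMap (φ : B →ₚ[ℂ] ℂ) (a b : B) :
    φ.gnsStarAlgHom a (φ.gnsMap b) = φ.gnsMap (a * b) := by
  rw [gnsMap_eq, gnsMap_eq, gnsStarAlgHom_apply]
  simp

theorem denseRange_gnsMap (φ : B →ₚ[ℂ] ℂ) : DenseRange φ.gnsMap :=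
  UniformSpace.Completion.denseRange_coe.comp φ.toPreGNS.surjective.denseRange
    (UniformSpace.Completion.continuous_coe _)

end PositiveLinearMap

/-- The compression of a representation of `B` to a subspace invariant under a ⋆-subalgebra. -/
theorem StarSubalgebra.exists_bimodule_map_of_intertwining {K : Type*} [NormedAddCommGroup K]
    [InnerProductSpace ℂ K] [CompleteSpace K] (D : StarSubalgebra ℂ B)
    (σ : D →⋆ₐ[ℂ] (H →L[ℂ] H)) (ρ : B →⋆ₐ[ℂ] (K →L[ℂ] K)) (V : H →ₗᵢ[ℂ] K)
    (hV : ∀ (d : D) x, V (σ d x) = ρ d (V x)) :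
    ∃ θ : B →ₗ[ℂ] (H →L[ℂ] H), (∀ b, 0 ≤ b → 0 ≤ θ b) ∧ θ 1 = 1 ∧
      (∀ (d : D) b, θ (d * b) = σ d * θ b) ∧ ∀ (d : D) b, θ (b * d) = θ b * σ d := by
  set W : H →L[ℂ] K := V.toContinuousLinearMap with hW
  have hint : ∀ d : D, W ∘L σ d = ρ d ∘L W := fun d => by
    ext1 x
    exact hV d x
  have hint' : ∀ d : D, W.adjoint ∘L ρ d = σ d ∘L W.adjoint := by
    intro d
    have h := congrArg ContinuousLinearMap.adjoint (hint (star d))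
    rw [ContinuousLinearMap.adjoint_comp, ContinuousLinearMap.adjoint_comp,
      ← ContinuousLinearMap.star_eq_adjoint, ← ContinuousLinearMap.star_eq_adjoint (ρ _),
      ← map_star, ← map_star, star_star, ← StarMemClass.coe_star, star_star] at h
    exact h.symm
  refine ⟨{ toFun := fun b => W.adjoint ∘L ρ b ∘L W
            map_add' := fun a b => by ext; simp
            map_smul' := fun r a => by ext; simp }, fun b hb => ?_, ?_, fun d b => ?_,
            fun d b => ?_⟩
  · have h1 : 0 ≤ ρ b := map_nonneg ρ hb
    rw [ContinuousLinearMap.nonneg_iff_isPositive] at h1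
    exact (ContinuousLinearMap.nonneg_iff_isPositive _).2 (h1.adjoint_conj W)
  · change W.adjoint ∘L ρ 1 ∘L W = 1
    rw [map_one]
    exact V.adjoint_comp_self
  · change W.adjoint ∘L ρ (d * b) ∘L W = σ d ∘L W.adjoint ∘L ρ b ∘L W
    rw [map_mul, ← ContinuousLinearMap.comp_assoc (σ d), ← hint']
    rfl
  · change W.adjoint ∘L ρ (b * d) ∘L W = (W.adjoint ∘L ρ b ∘L W) ∘L σ d
    rw [map_mul, ContinuousLinearMap.comp_assoc, ContinuousLinearMap.comp_assoc, hint]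
    rfl

/-- A representation of a closed unital ⋆-subalgebra `D` of `B` extends to a positive
`D`-bimodule map on `B`. -/
theorem StarSubalgebra.exists_positive_bimodule_extension (D : StarSubalgebra ℂ B)
    (hD : IsClosed (D : Set B)) (σ : D →⋆ₐ[ℂ] (H →L[ℂ] H)) :
    ∃ θ : B →ₗ[ℂ] (H →L[ℂ] H), (∀ b, 0 ≤ b → 0 ≤ θ b) ∧ θ 1 = 1 ∧
      (∀ (d : D) b, θ (d * b) = σ d * θ b) ∧ ∀ (d : D) b, θ (b * d) = θ b * σ d := by
  obtain ⟨S, e, he, hdense, horth⟩ := exists_cyclic_decomposition σ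
  -- The GNS space of the extension `φ s` contains a copy of the cyclic subspace generated by `s`.
  choose φ hφ using fun s : S => D.exists_extension_vector_functional hD σ (s : H)
  obtain ⟨V, hV⟩ := exists_linearIsometry_intertwining_directSum σ S e he hdense horth
    (fun s => (φ s).gnsStarAlgHom) D.subtype.toAlgHom.toLinearMap
    (fun s => (φ s).gnsMap ∘ₗ D.subtype.toAlgHom.toLinearMap)
    (fun s a b => (PositiveLinearMap.inner_gnsMap _ _ _).trans (hφ s (star a * b)))
    (fun s d a => PositiveLinearMap.gnsStarAlgHom_gnsMap _ _ _)
  exact D.exists_bimodule_map_of_intertwining σ _ V hV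

end Extension

/-! ### The multiplicative domain of a completely positive map -/

section MultiplicativeDomain

variable {H : Type*} [NormedAddCommGroup H] [InnerProductSpace ℂ H] [CompleteSpace H]

theorem inner_sum_star_mul_apply {n : Type*} [Fintype n] (P Q : n → (H →L[ℂ] H)) (u w : H) :
    inner ℂ u ((∑ k, star (P k) * Q k) w) = ∑ k, inner ℂ (P k u) (Q k w) := by
  rw [sum_apply, inner_sum]
  exact Finset.sum_congr rfl fun k _ => ContinuousLinearMap.adjoint_inner_right (P k) u (Q k w)

theorem CStarMatrix.star_mul_self_apply {n : Type*} [Fintype n]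
    (N : CStarMatrix n n (H →L[ℂ] H)) (i j : n) :
    (star N * N) i j = ∑ k, star (N k i) * N k j := by
  rw [CStarMatrix.mul_apply]
  simp only [CStarMatrix.star_apply]

/-- For `P = star N * N` the form is `∑ k, ‖∑ i, N k i (v i)‖²`, and such matrices generate the
positive cone. -/
theorem CStarMatrix.sum_re_inner_nonneg {n : Type*} [Fintype n] {P : CStarMatrix n n (H →L[ℂ] H)}
    (hP : 0 ≤ P) (v : n → H) : 0 ≤ (∑ i, ∑ j, inner ℂ (v i) (P i j (v j))).re := by
  rw [StarOrderedRing.nonneg_iff] at hP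
  induction hP using AddSubmonoid.closure_induction with
  | mem P hP =>
    obtain ⟨N, rfl⟩ := hP
    have h : ∑ i, ∑ j, inner ℂ (v i) ((star N * N) i j (v j)) =
        ∑ k, inner ℂ (∑ i, N k i (v i)) (∑ j, N k j (v j)) := by
      simp only [CStarMatrix.star_mul_self_apply, inner_sum_star_mul_apply]
      simp only [sum_inner, inner_sum]
      rw [Finset.sum_comm_cycle]
      exact Finset.sum_congr rfl fun k _ => Finset.sum_comm
    simp only [h, Complex.re_sum]
    exact Finset.sum_nonneg fun k _ => inner_self_nonneg (𝕜 := ℂ)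
  | zero => simp [CStarMatrix.zero_apply]
  | add P Q _ _ hP hQ =>
    simp only [CStarMatrix.add_apply, _root_.add_apply, inner_add_right,
      Finset.sum_add_distrib, Complex.add_re]
    exact add_nonneg hP hQ

/-- Choi's multiplicative domain argument. The image under `Φ` of the Gram matrix of `(star (π a),
T, 1)` is positive; its Schur complement with respect to the last entry `1` has upper left corner
`0`, so the off-diagonal entry `Φ (π a * T) - π a * Φ T` vanishes. -/
theorem CompletelyPositiveMap.map_mul_left_of_fixes {A : Type*} [CStarAlgebra A]
    (π : A →⋆ₐ[ℂ] (H →L[ℂ] H)) (Φ : (H →L[ℂ] H) →CP (H →L[ℂ] H)) (h1 : Φ 1 = 1)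
    (hΦ : ∀ a, Φ (π a) = π a) (a : A) (T : H →L[ℂ] H) : Φ (π a * T) = π a * Φ T := by
  have hstar : ∀ S, Φ (star S) = star (Φ S) := fun S => map_star Φ S
  let x : Fin 3 → (H →L[ℂ] H) := ![star (π a), T, 1]
  -- Only the first row is nonzero, so that `star N * N` is the Gram matrix of `x`.
  let N : CStarMatrix (Fin 3) (Fin 3) (H →L[ℂ] H) :=
    CStarMatrix.ofMatrix fun i j => if i = 0 then x j else 0
  have hN : ∀ i j, (star N * N) i j = star (x i) * x j := by
    intro i j
    have h0 : ∀ j, N 0 j = x j := fun j => by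
      change (if (0 : Fin 3) = 0 then x j else 0) = x j
      exact if_pos rfl
    have h1 : ∀ j, N 1 j = 0 := fun j => by
      change (if (1 : Fin 3) = 0 then x j else 0) = 0
      exact if_neg (by decide)
    have h2 : ∀ j, N 2 j = 0 := fun j => by
      change (if (2 : Fin 3) = 0 then x j else 0) = 0
      exact if_neg (by decide)
    rw [CStarMatrix.mul_apply, Fin.sum_univ_three]
    simp only [CStarMatrix.star_apply, h0, h1, h2, mul_zero, add_zero]
  have hpos := Φ.map_cstarMatrix_nonneg _ (star_mul_self_nonneg N)
  have e00 : Φ (star (x 0) * x 0) = π a * star (π a) := by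
    simp only [x, Matrix.cons_val_zero, star_star, ← map_star, ← map_mul, hΦ]
  have e01 : Φ (star (x 0) * x 1) = Φ (π a * T) := by simp [x]
  have e02 : Φ (star (x 0) * x 2) = π a := by simp [x, hΦ]
  have e10 : Φ (star (x 1) * x 0) = star (Φ (π a * T)) := by rw [← hstar]; simp [x]
  have e12 : Φ (star (x 1) * x 2) = star (Φ T) := by rw [← hstar]; simp [x]
  have e20 : Φ (star (x 2) * x 0) = star (π a) := by
    rw [← map_star, ← hΦ (star a), map_star]; simp [x]
  have e21 : Φ (star (x 2) * x 1) = Φ T := by simp [x]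
  have e22 : Φ (star (x 2) * x 2) = 1 := by simp [x, h1]
  ext1 η
  rw [← sub_eq_zero]
  set ξ := Φ (π a * T) η - (π a * Φ T) η with hξ
  have quad : ∀ t : ℝ, 0 ≤ ((inner ℂ η (Φ (star (x 1) * x 1) η)).re - ‖Φ T η‖ ^ 2) * (t * t) +
      2 * ‖ξ‖ ^ 2 * t + 0 := by
    intro t
    have h := CStarMatrix.sum_re_inner_nonneg hpos
      -- The third entry minimises the quadratic form for the given first two.
      ![ξ, (t : ℂ) • η, -(star (π a) ξ) - (t : ℂ) • Φ T η]
    simp only [Fin.sum_univ_three, CStarMatrix.map_apply, hN, e00, e01, e02, e10, e12, e20, e21,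
      e22, Matrix.cons_val_zero, Matrix.cons_val_one, Matrix.cons_val] at h
    simp only [ContinuousLinearMap.star_eq_adjoint] at h
    have hadj : ∀ (P : H →L[ℂ] H) (u v : H), inner ℂ u (P v) = inner ℂ (P.adjoint u) v :=
      fun P u v => (ContinuousLinearMap.adjoint_inner_left P v u).symm
    have hξξ : inner ℂ ξ ξ = inner ℂ ξ (Φ (π a * T) η) - inner ℂ ((π a).adjoint ξ) (Φ T η) := by
      rw [← hadj, ← inner_sub_right]; rfl
    have hξξ' : inner ℂ ξ ξ = inner ℂ (Φ (π a * T) η) ξ - inner ℂ (Φ T η) ((π a).adjoint ξ) := by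
      rw [ContinuousLinearMap.adjoint_inner_right, ← inner_sub_left]; rfl
    have hre : ‖ξ‖ ^ 2 = (inner ℂ ξ ξ).re := by
      rw [← @inner_self_eq_norm_sq ℂ]; rfl
    have hre' : ‖Φ T η‖ ^ 2 = (inner ℂ (Φ T η) (Φ T η)).re := by
      rw [← @inner_self_eq_norm_sq ℂ]; rfl
    refine h.trans_eq ?_
    have h2 : 2 * ‖ξ‖ ^ 2 = (inner ℂ ξ (Φ (π a * T) η) - inner ℂ ((π a).adjoint ξ) (Φ T η) +
      (inner ℂ (Φ (π a * T) η) ξ - inner ℂ (Φ T η) ((π a).adjoint ξ))).re := by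
      rw [← hξξ, ← hξξ', hre, Complex.add_re]; ring
    rw [h2, hre', ← Complex.sub_re]
    have hmul : ∀ z : ℂ, z.re * t = (z * t).re := fun z => by simp
    have hmul' : ∀ z : ℂ, z.re * (t * t) = (z * (t * t)).re := fun z => by
      rw [← Complex.ofReal_mul]; simp
    rw [hmul, hmul', ← Complex.add_re, add_zero]
    congr 1
    simp only [mul_apply_eq_comp, one_apply_eq_self, ContinuousLinearMap.star_eq_adjoint, inner_sub_left,
      inner_sub_right, inner_neg_left, inner_neg_right, inner_smul_left, inner_smul_right, map_smul,
      map_sub, map_neg, Complex.conj_ofReal, ContinuousLinearMap.adjoint_inner_right, hadj (π a)]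
    ring
  -- With zero constant term, nonnegativity for all `t` forces the linear coefficient `2 * ‖ξ‖ ^ 2`
  -- to vanish.
  have hd := discrim_le_zero quad
  rw [discrim] at hd
  have : ‖ξ‖ ^ 2 = 0 := by nlinarith [sq_nonneg (‖ξ‖ ^ 2)]
  simpa using this

theorem CompletelyPositiveMap.map_mul_right_of_fixes {A : Type*} [CStarAlgebra A]
    (π : A →⋆ₐ[ℂ] (H →L[ℂ] H)) (Φ : (H →L[ℂ] H) →CP (H →L[ℂ] H)) (h1 : Φ 1 = 1)
    (hΦ : ∀ a, Φ (π a) = π a) (a : A) (T : H →L[ℂ] H) : Φ (T * π a) = Φ T * π a := by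
  have hstar : ∀ S, Φ (star S) = star (Φ S) := fun S => map_star Φ S
  have h := Φ.map_mul_left_of_fixes π h1 hΦ (star a) (star T)
  rw [map_star, ← star_mul, hstar, hstar, ← star_mul] at h
  exact star_injective h

end MultiplicativeDomain

/-! ### Hypertraces from the weak expectation property -/

section Hypertrace

variable {A : Type v} [CStarAlgebra A]

section

variable [PartialOrder A] [StarOrderedRing A]

/-- An isometry commuting with a summand of a direct sum of representations acts on the whole
direct sum. -/
theorem exists_commuting_single {ι : Type*} [DecidableEq ι] {G : ι → Type*}
    [∀ i, NormedAddCommGroup (G i)] [∀ i, InnerProductSpace ℂ (G i)] [∀ i, CompleteSpace (G i)]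
    {B : Type*} [CStarAlgebra B] (ρ : ∀ i, B →⋆ₐ[ℂ] (G i →L[ℂ] G i)) (i : ι)
    (R : G i →ₗᵢ[ℂ] G i) (hR : ∀ b x, R (ρ i b x) = ρ i b (R x)) :
    ∃ W : lp G 2 →L[ℂ] lp G 2, (∀ x, W x = lp.single 2 i (R (x i))) ∧
      ∀ b, directSumRep ρ b * W = W * directSumRep ρ b := by
  let W : lp G 2 →L[ℂ] lp G 2 := lp.singleContinuousLinearMap ℂ G 2 i ∘L
    R.toContinuousLinearMap ∘L lp.evalCLM ℂ G 2 i
  have hW : ∀ x, W x = lp.single 2 i (R (x i)) := fun x => rfl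
  refine ⟨W, hW, fun b => ?_⟩
  ext1 x
  change directSumRep ρ b (W x) = W (directSumRep ρ b x)
  rw [hW, hW, directSumRep_single, directSumRep_apply, hR]

/-- The direct sum of the GNS representations of all positive functionals. -/
noncomputable def universalRep :
    A →⋆ₐ[ℂ] (lp (fun f : A →ₚ[ℂ] ℂ => f.GNS) 2 →L[ℂ] lp (fun f : A →ₚ[ℂ] ℂ => f.GNS) 2) :=
  directSumRep fun f => f.gnsStarAlgHom

/-- The cyclic vector of the GNS representation of `f`, in the universal representation. -/
noncomputable def universalVector [DecidableEq (A →ₚ[ℂ] ℂ)] (f : A →ₚ[ℂ] ℂ) :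
    lp (fun f : A →ₚ[ℂ] ℂ => f.GNS) 2 :=
  lp.single 2 f (f.gnsMap 1)

theorem universalRep_universalVector [DecidableEq (A →ₚ[ℂ] ℂ)] (f : A →ₚ[ℂ] ℂ) (a : A) :
    universalRep a (universalVector f) = lp.single 2 f (f.gnsMap a) := by
  rw [universalRep, universalVector, directSumRep_single,
    PositiveLinearMap.gnsStarAlgHom_gnsMap, mul_one]

theorem universalRep_injective :
    Function.Injective (universalRep (A := A)) := by
  classical
  rw [injective_iff_map_eq_zero]
  intro a ha
  by_contra h
  obtain ⟨φ, hφ⟩ := exists_positiveLinearMap_star_mul_self_ne_zero h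
  apply hφ
  have h1 := universalRep_universalVector φ a
  rw [ha, zero_apply] at h1
  have h2 := congrArg (fun x : lp (fun f : A →ₚ[ℂ] ℂ => f.GNS) 2 => x φ) h1
  simp only [lp.single_apply_self] at h2
  rw [← PositiveLinearMap.inner_gnsMap, ← h2]
  exact inner_zero_left _

/-- Right multiplication by a unitary acts on the GNS space of a trace. -/
theorem PositiveLinearMap.exists_right_mul_isometry (f : A →ₚ[ℂ] ℂ)
    (hf : ∀ a b, f (a * b) = f (b * a)) {v : A} (hv : v * star v = 1) :
    ∃ R : f.GNS →ₗᵢ[ℂ] f.GNS, (∀ a, R (f.gnsMap a) = f.gnsMap (a * v)) ∧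
      ∀ b x, R (f.gnsStarAlgHom b x) = f.gnsStarAlgHom b (R x) := by
  -- Isometric because `f(v* a* a v) = f(a* a v v*) = f(a* a)`.
  obtain ⟨R, hR⟩ := exists_linearIsometry_of_denseRange f.gnsMap
    (f.gnsMap ∘ₗ LinearMap.mulRight ℂ v) f.denseRange_gnsMap fun a => by
      rw [@norm_eq_sqrt_re_inner ℂ, @norm_eq_sqrt_re_inner ℂ, LinearMap.comp_apply,
        LinearMap.mulRight_apply, inner_gnsMap, inner_gnsMap, star_mul, mul_assoc, hf, mul_assoc,
        mul_assoc, hv, mul_one]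
  have hR' : ∀ a, R (f.gnsMap a) = f.gnsMap (a * v) := hR
  refine ⟨R, hR', fun b x => ?_⟩
  refine f.denseRange_gnsMap.induction
    (P := fun x => R (f.gnsStarAlgHom b x) = f.gnsStarAlgHom b (R x)) ?_ ?_ x
  · rintro _ ⟨a, rfl⟩
    rw [gnsStarAlgHom_gnsMap, hR', hR', gnsStarAlgHom_gnsMap, mul_assoc]
  · exact isClosed_eq (by fun_prop) (by fun_prop)

/-- At the trace vector, left and right multiplication by `v` agree, and right multiplication is in
the commutant. `W` is zero on the other summands, hence isometric only against `universalVector f`.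
-/
theorem exists_commutant_isometry_universalRep [DecidableEq (A →ₚ[ℂ] ℂ)] (f : A →ₚ[ℂ] ℂ)
    (hf : ∀ a b, f (a * b) = f (b * a)) {v : A} (hv : v * star v = 1) :
    ∃ W ∈ Set.centralizer (Set.range (universalRep (A := A))),
      W (universalVector f) = universalRep v (universalVector f) ∧
      ∀ x, inner ℂ (W (universalVector f)) (W x) = inner ℂ (universalVector f) x := by
  obtain ⟨R, hR, hcomm⟩ := f.exists_right_mul_isometry hf hv
  obtain ⟨W, hW, hWcomm⟩ := exists_commuting_single
    (fun f : A →ₚ[ℂ] ℂ => f.gnsStarAlgHom) f R hcomm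
  refine ⟨W, ?_, ?_, fun x => ?_⟩
  · rintro _ ⟨a, rfl⟩
    exact hWcomm a
  · rw [universalRep_universalVector, hW, universalVector, lp.single_apply_self, hR, one_mul]
  · rw [hW, hW, lp.inner_single_left, lp.single_apply_self, R.inner_map_map, universalVector,
      lp.single_apply_self, lp.inner_single_left]

end

/-- A tracial state of a C⋆-algebra with the weak expectation property extends to a state on
some `B(H)` that is invariant under conjugation by the unitaries of the C⋆-algebra. -/
theorem HasWEP.exists_hypertrace (hA : HasWEP A) {τ : A →ₗ[ℂ] ℂ} (hτ : IsTracialState τ) :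
    ∃ (H : Type v) (_ : NormedAddCommGroup H) (_ : InnerProductSpace ℂ H) (_ : CompleteSpace H)
      (π : A →⋆ₐ[ℂ] (H →L[ℂ] H)) (ψ : (H →L[ℂ] H) →ₗ[ℂ] ℂ), (∀ T, 0 ≤ T → 0 ≤ ψ T) ∧ ψ 1 = 1 ∧
      ∀ a : A, star a * a = 1 → a * star a = 1 →
        ∀ T, ψ (π a * T * π (star a)) = ψ T := by
  classical
  let _ : PartialOrder A := CStarAlgebra.spectralOrder A
  have _ : StarOrderedRing A := CStarAlgebra.spectralOrderedRing A
  let f : A →ₚ[ℂ] ℂ := PositiveLinearMap.mk₀ τ fun x hx => by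
    obtain ⟨y, rfl⟩ := CStarAlgebra.nonneg_iff_eq_star_mul_self.1 hx
    exact hτ.nonneg y
  have hfτ : ∀ a, f a = τ a := fun a => rfl
  obtain ⟨Φ, hmem, hone, hfix⟩ := hA _ (universalRep (A := A)) universalRep_injective
  let ξ := universalVector f
  refine ⟨lp (fun f : A →ₚ[ℂ] ℂ => f.GNS) 2, inferInstance, inferInstance, inferInstance,
    universalRep,
    { toFun := fun T => inner ℂ ξ (Φ T ξ)
      map_add' := fun S T => by simp
      map_smul' := fun c T => by simp }, fun T hT => ?_, ?_, fun a ha ha' T => ?_⟩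
  · have h : 0 ≤ Φ T := map_nonneg Φ hT
    exact ((ContinuousLinearMap.nonneg_iff_isPositive _).1 h).inner_nonneg_right ξ
  · change inner ℂ ξ (Φ 1 ξ) = 1
    rw [hone, one_apply_eq_self]
    rw [show ξ = universalVector f from rfl, universalVector, lp.inner_single_left, lp.single_apply_self, PositiveLinearMap.inner_gnsMap, hfτ,
      star_one, one_mul, hτ.map_one]
  · change inner ℂ ξ (Φ _ ξ) = inner ℂ ξ (Φ T ξ)
    obtain ⟨W, hW, hWξ, hWinner⟩ := exists_commutant_isometry_universalRep f
      (fun a b => hτ.map_mul_comm a b) (v := star a) (by rw [star_star, ha])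
    have hcomm : W * Φ T = Φ T * W := hmem T W hW
    have hcommξ : Φ T (W ξ) = W (Φ T ξ) := (DFunLike.congr_fun hcomm ξ).symm
    -- Now `⟪ξ, a Φ(T) a* ξ⟫ = ⟪W ξ, Φ(T) W ξ⟫ = ⟪W ξ, W Φ(T) ξ⟫ = ⟪ξ, Φ(T) ξ⟫`.
    rw [Φ.map_mul_right_of_fixes _ hone hfix, Φ.map_mul_left_of_fixes _ hone hfix]
    have hstar : (universalRep a).adjoint = universalRep (star a) := by
      rw [map_star, ContinuousLinearMap.star_eq_adjoint]
    change inner ℂ ξ (universalRep a (Φ T (universalRep (star a) ξ))) = _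
    rw [← ContinuousLinearMap.adjoint_inner_left, hstar, ← hWξ, hcommξ, hWinner]

end Hypertrace

/-! ### Multiplication operators and invariant means -/

section Multiplication

variable (Γ : Type u)

/-- The multiplication operator on `ℓ²(Γ)` by a bounded real function. -/
noncomputable def multiplicationOperator :
    lp (fun _ : Γ => ℝ) ∞ →ₗ[ℝ] (lp (fun _ : Γ => ℂ) 2 →L[ℂ] lp (fun _ : Γ => ℂ) 2) where
  toFun f := lp.mapCLM 2 (fun x => (f x : ℂ) • ContinuousLinearMap.id ℂ ℂ) (norm_nonneg f)
    fun x => by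
      refine (norm_smul_le _ _).trans ?_
      rw [ContinuousLinearMap.norm_id, mul_one, Complex.norm_real]
      exact lp.norm_apply_le_norm (by simp) f x
  map_add' f g := by
    ext; simp [add_mul]
  map_smul' c f := by
    ext; simp [mul_assoc]

variable {Γ}

theorem multiplicationOperator_apply (f : lp (fun _ : Γ => ℝ) ∞) (ξ : lp (fun _ : Γ => ℂ) 2)
    (x : Γ) : multiplicationOperator Γ f ξ x = f x * ξ x := by
  simp [multiplicationOperator]

theorem multiplicationOperator_one : multiplicationOperator Γ 1 = 1 := by
  ext ξ x
  simp [multiplicationOperator_apply]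

theorem multiplicationOperator_nonneg {f : lp (fun _ : Γ => ℝ) ∞} (hf : ∀ x, 0 ≤ f x) :
    0 ≤ multiplicationOperator Γ f := by
  rw [ContinuousLinearMap.nonneg_iff_isPositive, ContinuousLinearMap.isPositive_iff_complex]
  have h : ∀ ξ, 0 ≤ inner ℂ (multiplicationOperator Γ f ξ) ξ := by
    intro ξ
    rw [lp.inner_eq_tsum]
    refine tsum_nonneg fun x => ?_
    rw [multiplicationOperator_apply, ← smul_eq_mul, inner_smul_left, Complex.conj_ofReal]
    exact mul_nonneg (by exact_mod_cast hf x) (by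
      rw [inner_self_eq_norm_sq_to_K, ← RCLike.ofReal_pow]
      exact RCLike.ofReal_nonneg.2 (sq_nonneg _))
  intro ξ
  obtain ⟨h1, h2⟩ := Complex.nonneg_iff.1 (h ξ)
  exact ⟨Complex.ext rfl (by simpa using h2), h1⟩

variable [Group Γ]

theorem leftRegular_apply (g : Γ) (ξ : lp (fun _ : Γ => ℂ) 2) (x : Γ) :
    leftRegular Γ g ξ x = ξ (g⁻¹ * x) := rfl

theorem leftRegular_mul (g h : Γ) : leftRegular Γ (g * h) = leftRegular Γ g * leftRegular Γ h := by
  ext ξ x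
  change ξ _ = ξ _
  rw [mul_inv_rev, mul_assoc]

theorem leftRegular_one : leftRegular Γ 1 = 1 := by
  ext ξ x
  change ξ _ = ξ _
  rw [inv_one, one_mul]

theorem star_leftRegular (g : Γ) : star (leftRegular Γ g) = leftRegular Γ g⁻¹ := by
  have h1 : star (leftRegular Γ g) * leftRegular Γ g = 1 :=
    (leftRegularIsometry Γ g).adjoint_comp_self
  have h2 : leftRegular Γ g * leftRegular Γ g⁻¹ = 1 := by
    rw [← leftRegular_mul, mul_inv_cancel, leftRegular_one]
  exact left_inv_eq_right_inv h1 h2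

/-- This covariance turns invariance under conjugation into invariance under translation. -/
theorem multiplicationOperator_leftTranslate (g : Γ) (f : lp (fun _ : Γ => ℝ) ∞) :
    multiplicationOperator Γ (leftTranslate g f) =
      leftRegular Γ g * multiplicationOperator Γ f * star (leftRegular Γ g) := by
  rw [star_leftRegular]
  ext ξ x
  change multiplicationOperator Γ (leftTranslate g f) ξ x =
    multiplicationOperator Γ f (leftRegular Γ g⁻¹ ξ) (g⁻¹ * x)
  rw [multiplicationOperator_apply, multiplicationOperator_apply, leftRegular_apply, inv_inv,
    mul_inv_cancel_left, leftTranslate_apply]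

theorem leftRegular_mem (g : Γ) : leftRegular Γ g ∈ reducedGroupCStarAlgebra Γ :=
  StarSubalgebra.le_topologicalClosure _ (StarAlgebra.subset_adjoin ℂ _ ⟨g, rfl⟩)

theorem isClosed_reducedGroupCStarAlgebra :
    IsClosed (reducedGroupCStarAlgebra Γ :
      Set (lp (fun _ : Γ => ℂ) 2 →L[ℂ] lp (fun _ : Γ => ℂ) 2)) :=
  StarSubalgebra.isClosed_topologicalClosure _

theorem isAmenableGroup_of_hasWEP {A : Type v} [CStarAlgebra A] (hA : HasWEP A) {τ : A →ₗ[ℂ] ℂ}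
    (hτ : IsTracialState τ) (j : reducedGroupCStarAlgebra Γ →⋆ₐ[ℂ] A) : IsAmenableGroup Γ := by
  obtain ⟨H, _, _, _, π, ψ, hψ, hψ1, hinv⟩ := hA.exists_hypertrace hτ
  obtain ⟨θ, hθ, hθ1, hθl, hθr⟩ :=
    (reducedGroupCStarAlgebra Γ).exists_positive_bimodule_extension
      isClosed_reducedGroupCStarAlgebra (π.comp j)
  refine ⟨Complex.reLm ∘ₗ (ψ ∘ₗ θ).restrictScalars ℝ ∘ₗ multiplicationOperator Γ,
    fun f hf => ?_, ?_, fun g f => ?_⟩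
  · exact (Complex.nonneg_iff.1 (hψ _ (hθ _ (multiplicationOperator_nonneg hf)))).1
  · change (ψ (θ (multiplicationOperator Γ 1))).re = 1
    rw [multiplicationOperator_one, hθ1, hψ1, Complex.one_re]
  · change (ψ (θ (multiplicationOperator Γ (leftTranslate g f)))).re =
      (ψ (θ (multiplicationOperator Γ f))).re
    let d : reducedGroupCStarAlgebra Γ := ⟨leftRegular Γ g, leftRegular_mem g⟩
    have h1 : star (leftRegular Γ g) * leftRegular Γ g = 1 := by
      rw [star_leftRegular, ← leftRegular_mul, inv_mul_cancel, leftRegular_one]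
    have h2 : leftRegular Γ g * star (leftRegular Γ g) = 1 := by
      rw [star_leftRegular, ← leftRegular_mul, mul_inv_cancel, leftRegular_one]
    have hd1 : star d * d = 1 := Subtype.ext h1
    have hd2 : d * star d = 1 := Subtype.ext h2
    have key : θ (multiplicationOperator Γ (leftTranslate g f)) =
        π (j d) * θ (multiplicationOperator Γ f) * π (star (j d)) := by
      have h3 : multiplicationOperator Γ (leftTranslate g f) =
          (d : lp (fun _ : Γ => ℂ) 2 →L[ℂ] lp (fun _ : Γ => ℂ) 2) * multiplicationOperator Γ f *
            (star d : reducedGroupCStarAlgebra Γ) := multiplicationOperator_leftTranslate g f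
      rw [h3, hθr, hθl, ← map_star j]
      rfl
    rw [key, hinv (j d) (by rw [← map_star, ← map_mul, hd1, map_one])
      (by rw [← map_star, ← map_mul, hd2, map_one])]

end Multiplication

/-! ### Almost invariant vectors -/

section AlmostInvariant

variable {Γ : Type u}

/-- For a bounded linear functional on `ℓ¹(Γ)`, the corresponding bounded function on `Γ`. -/
noncomputable def dualFunction [DecidableEq Γ] (ψ : lp (fun _ : Γ => ℝ) 1 →L[ℝ] ℝ) :
    lp (fun _ : Γ => ℝ) ∞ :=
  ⟨fun x => ψ (lp.single 1 x 1), memℓp_infty ⟨‖ψ‖, by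
    rintro _ ⟨x, rfl⟩
    refine (ψ.le_opNorm _).trans_eq ?_
    rw [lp.norm_single (by norm_num), norm_one, mul_one]⟩⟩

theorem dualFunction_apply [DecidableEq Γ] (ψ : lp (fun _ : Γ => ℝ) 1 →L[ℝ] ℝ) (x : Γ) :
    dualFunction ψ x = ψ (lp.single 1 x 1) := rfl

theorem hasSum_norm_sq_l2 (ξ : lp (fun _ : Γ => ℂ) 2) : HasSum (fun x => ‖ξ x‖ ^ 2) (‖ξ‖ ^ 2) := by
  have := lp.hasSum_norm (p := 2) (by norm_num) ξ
  simpa using this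

variable [Group Γ]

/-- Day's convexity argument: a functional separating `0` from the hull yields bounded functions
whose differences with their translates sum to at least `t > 0` everywhere, while the invariant mean
of that sum is `0`. Working in the product over `F` treats all `g ∈ F` at once. -/
theorem IsAmenableGroup.zero_mem_closure [DecidableEq Γ] (h : IsAmenableGroup Γ) (F : Finset Γ) :
    (0 : F → lp (fun _ : Γ => ℝ) 1) ∈ closure (convexHull ℝ (Set.range
      fun (x : Γ) (g : F) => lp.single (E := fun _ : Γ => ℝ) 1 ((g : Γ) * x) (1 : ℝ) -
        lp.single (E := fun _ : Γ => ℝ) 1 x (1 : ℝ))) := by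
  by_contra h0
  obtain ⟨m, hm, hm1, hinv⟩ := h
  obtain ⟨Λ, t, ht, hΛ⟩ := geometric_hahn_banach_point_closed
    (convex_convexHull ℝ _).closure isClosed_closure h0
  rw [map_zero] at ht
  let ψ : F → (lp (fun _ : Γ => ℝ) 1 →L[ℝ] ℝ) := fun g =>
    Λ ∘L ContinuousLinearMap.single ℝ (fun _ : F => lp (fun _ : Γ => ℝ) 1) g
  have hψ : ∀ c, Λ c = ∑ g, ψ g (c g) := fun c => by
    conv_lhs => rw [← Finset.univ_sum_single c, map_sum]
    rfl
  let k : lp (fun _ : Γ => ℝ) ∞ :=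
    ∑ g : F, (leftTranslate (g : Γ)⁻¹ (dualFunction (ψ g)) - dualFunction (ψ g)) - t • 1
  have hk : ∀ x, 0 ≤ k x := by
    intro x
    have h1 := hΛ _ (subset_closure (subset_convexHull ℝ _ ⟨x, rfl⟩))
    rw [hψ] at h1
    have h2 : k x = ∑ g : F, ψ g (lp.single 1 ((g : Γ) * x) 1 - lp.single 1 x 1) - t := by
      simp only [k, lp.coeFn_sub, lp.coeFn_sum, lp.coeFn_smul, Pi.sub_apply, Finset.sum_apply,
        Pi.smul_apply, leftTranslate_apply, dualFunction_apply, inv_inv, map_sub]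
      simp
    rw [h2]
    linarith
  have h3 := hm k hk
  have h4 : m k = -t := by
    simp only [k, map_sub, map_sum, map_smul, hinv, sub_self, hm1]
    simp
  linarith

theorem IsAmenableGroup.exists_almost_invariant_l1 (h : IsAmenableGroup Γ) (F : Finset Γ) {ε : ℝ}
    (hε : 0 < ε) : ∃ f : lp (fun _ : Γ => ℝ) 1, (∀ x, 0 ≤ f x) ∧ HasSum (fun x => f x) 1 ∧
      ∀ g ∈ F, ‖leftTranslate g f - f‖ < ε := by
  classical
  obtain ⟨c, hc, hcε⟩ := Metric.mem_closure_iff.1 (h.zero_mem_closure F) ε hε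
  -- `K` is convex and contains the generators, which come from point masses; hence every point of
  -- the hull comes from a probability density.
  let K : Set (F → lp (fun _ : Γ => ℝ) 1) := {c | ∃ f : lp (fun _ : Γ => ℝ) 1,
    (∀ x, 0 ≤ f x) ∧ HasSum (fun x => f x) 1 ∧ ∀ g : F, c g = leftTranslate (g : Γ) f - f}
  have hK : Convex ℝ K := by
    rintro c ⟨f, hf, hf1, hfc⟩ d ⟨f', hf', hf1', hfd⟩ a b ha hb hab
    refine ⟨a • f + b • f', fun x => ?_, ?_, fun g => ?_⟩
    · exact add_nonneg (mul_nonneg ha (hf x)) (mul_nonneg hb (hf' x))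
    · have := (hf1.mul_left a).add (hf1'.mul_left b)
      rw [mul_one, mul_one, hab] at this
      exact this
    · rw [Pi.add_apply, Pi.smul_apply, Pi.smul_apply, hfc, hfd]
      ext x
      simp only [lp.coeFn_add, lp.coeFn_sub, lp.coeFn_smul, Pi.add_apply, Pi.sub_apply,
        Pi.smul_apply, leftTranslate_apply]
      simp only [smul_eq_mul]
      ring
  have hsub : convexHull ℝ (Set.range
      fun (x : Γ) (g : F) => lp.single (E := fun _ : Γ => ℝ) 1 ((g : Γ) * x) (1 : ℝ) -
        lp.single (E := fun _ : Γ => ℝ) 1 x (1 : ℝ)) ⊆ K := by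
    refine convexHull_min ?_ hK
    rintro _ ⟨x, rfl⟩
    refine ⟨lp.single 1 x 1, fun y => ?_, ?_, fun g => ?_⟩
    · rw [lp.single_apply, Pi.single_apply]
      split_ifs <;> norm_num
    · have := hasSum_ite_eq x (1 : ℝ)
      refine this.congr_fun fun y => ?_
      rw [lp.single_apply, Pi.single_apply]
    · have h1 : lp.single (E := fun _ : Γ => ℝ) 1 ((g : Γ) * x) (1 : ℝ) =
          leftTranslate (g : Γ) (lp.single 1 x 1) := by
        ext y
        rw [leftTranslate_apply, lp.single_apply, lp.single_apply, Pi.single_apply,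
          Pi.single_apply]
        simp only [inv_mul_eq_iff_eq_mul]
      rw [← h1]
  obtain ⟨f, hf, hf1, hfc⟩ := hsub hc
  refine ⟨f, hf, hf1, fun g hg => ?_⟩
  rw [dist_zero_left] at hcε
  rw [← hfc ⟨g, hg⟩]
  exact (norm_le_pi_norm c ⟨g, hg⟩).trans_lt hcε

theorem sq_sqrt_sub_sqrt_le {a b : ℝ} (ha : 0 ≤ a) (hb : 0 ≤ b) : (√a - √b) ^ 2 ≤ |a - b| := by
  have h1 : a - b = (√a - √b) * (√a + √b) := by
    rw [mul_comm, ← sq_sub_sq, Real.sq_sqrt ha, Real.sq_sqrt hb]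
  have h2 : |√a - √b| ≤ √a + √b := by
    rw [abs_le]
    constructor <;> linarith [Real.sqrt_nonneg a, Real.sqrt_nonneg b]
  rw [h1, abs_mul, abs_of_nonneg (add_nonneg (Real.sqrt_nonneg a) (Real.sqrt_nonneg b)),
    ← sq_abs, sq]
  exact mul_le_mul_of_nonneg_left h2 (abs_nonneg _)

theorem IsAmenableGroup.exists_almost_invariant_l2 (h : IsAmenableGroup Γ) (F : Finset Γ) {ε : ℝ}
    (hε : 0 < ε) : ∃ ξ : lp (fun _ : Γ => ℂ) 2, ‖ξ‖ = 1 ∧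
      ∀ g ∈ F, ‖leftRegular Γ g ξ - ξ‖ < ε := by
  -- Take `ξ = √f`: as `(√a - √b)² ≤ |a - b|`, an `ℓ¹` tolerance of `ε²` gives the `ℓ²` tolerance
  -- `ε`.
  obtain ⟨f, hf, hf1, hfF⟩ := h.exists_almost_invariant_l1 F (sq_pos_of_pos hε)
  have hnorm : ∀ x, ‖((√(f x) : ℝ) : ℂ)‖ ^ 2 = f x := fun x => by
    rw [Complex.norm_real, Real.norm_eq_abs, sq_abs, Real.sq_sqrt (hf x)]
  let ξ : lp (fun _ : Γ => ℂ) 2 := ⟨fun x => ((√(f x) : ℝ) : ℂ), memℓp_gen (by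
    simpa [Real.sq_sqrt (hf _)] using hf1.summable)⟩
  have hξ : ∀ x, ξ x = ((√(f x) : ℝ) : ℂ) := fun x => rfl
  refine ⟨ξ, ?_, fun g hg => ?_⟩
  · have h1 := hasSum_norm_sq_l2 ξ
    simp only [hξ, hnorm] at h1
    have h2 := h1.unique hf1
    exact (pow_eq_one_iff_of_nonneg (norm_nonneg _) two_ne_zero).1 h2
  · refine lt_of_pow_lt_pow_left₀ 2 hε.le (lt_of_le_of_lt ?_ (hfF g hg))
    have h1 := hasSum_norm_sq_l2 (leftRegular Γ g ξ - ξ)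
    have h2 : HasSum (fun x => |f (g⁻¹ * x) - f x|) ‖leftTranslate g f - f‖ := by
      have := lp.hasSum_norm (p := 1) (by norm_num) (leftTranslate g f - f)
      simpa using this
    refine hasSum_le (fun x => ?_) h1 h2
    have h3 : (leftRegular Γ g ξ - ξ) x = ((√(f (g⁻¹ * x)) - √(f x) : ℝ) : ℂ) := by
      rw [Complex.ofReal_sub]; rfl
    rw [h3, Complex.norm_real, Real.norm_eq_abs, sq_abs]
    exact sq_sqrt_sub_sqrt_le (hf _) (hf _)

/-- An amenable group has an invariant state on the bounded operators on `ℓ²(Γ)`. -/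
theorem IsAmenableGroup.exists_state (h : IsAmenableGroup Γ) :
    ∃ χ : (lp (fun _ : Γ => ℂ) 2 →L[ℂ] lp (fun _ : Γ => ℂ) 2) →ₚ[ℂ] ℂ, χ 1 = 1 ∧
      ∀ g, χ (leftRegular Γ g) = 1 := by
  classical
  choose ξ hξ hξF using fun i : Finset Γ × ℕ =>
    h.exists_almost_invariant_l2 i.1 (Nat.one_div_pos_of_nat (α := ℝ) (n := i.2))
  -- Along an ultrafilter the bounded vector functionals converge at every `T` simultaneously.
  let U : Ultrafilter (Finset Γ × ℕ) := Ultrafilter.of Filter.atTop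
  have hU : (U : Filter (Finset Γ × ℕ)) ≤ Filter.atTop := Ultrafilter.of_le _
  have hlim : ∀ T : lp (fun _ : Γ => ℂ) 2 →L[ℂ] lp (fun _ : Γ => ℂ) 2, ∃ z : ℂ,
      Filter.Tendsto (fun i => inner ℂ (ξ i) (T (ξ i))) U (nhds z) := by
    intro T
    obtain ⟨z, -, hz⟩ := (isCompact_closedBall (0 : ℂ) ‖T‖).ultrafilter_le_nhds
      (U.map fun i => inner ℂ (ξ i) (T (ξ i))) (by
        rw [Filter.le_principal_iff]
        refine Filter.mem_map.2 (Filter.univ_mem' fun i => ?_)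
        rw [Set.mem_preimage, mem_closedBall_zero_iff]
        refine (norm_inner_le_norm _ _).trans ?_
        rw [hξ, one_mul]
        simpa [hξ] using T.le_opNorm (ξ i))
    exact ⟨z, hz⟩
  choose χ hχ using hlim
  refine ⟨PositiveLinearMap.mk₀
    { toFun := χ
      map_add' := fun S T => tendsto_nhds_unique (hχ _) (by
        simpa [inner_add_right] using (hχ S).add (hχ T))
      map_smul' := fun c T => tendsto_nhds_unique (hχ _) (by
        simpa [inner_smul_right] using (hχ T).const_mul c) } fun T hT => ?_, ?_, fun g => ?_⟩
  · rw [ContinuousLinearMap.nonneg_iff_isPositive] at hT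
    exact ge_of_tendsto' (hχ T) fun i => hT.inner_nonneg_right _
  · refine tendsto_nhds_unique (hχ 1) ?_
    have : ∀ i, inner ℂ (ξ i) ((1 : lp (fun _ : Γ => ℂ) 2 →L[ℂ] lp (fun _ : Γ => ℂ) 2) (ξ i)) =
        (1 : ℂ) := fun i => by
      rw [one_apply_eq_self, inner_self_eq_norm_sq_to_K, hξ]
      simp
    simp only [this]
    exact tendsto_const_nhds
  · refine tendsto_nhds_unique (hχ _) (Filter.Tendsto.mono_left ?_ hU)
    rw [tendsto_iff_norm_sub_tendsto_zero]
    have hz : Filter.Tendsto (fun i : Finset Γ × ℕ => 1 / ((i.2 : ℝ) + 1)) Filter.atTop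
        (nhds 0) := by
      rw [← Filter.prod_atTop_atTop_eq]
      exact tendsto_one_div_add_atTop_nhds_zero_nat.comp Filter.tendsto_snd
    refine squeeze_zero' (Filter.Eventually.of_forall fun i => norm_nonneg _) ?_ hz
    filter_upwards [Filter.eventually_ge_atTop ({g}, 0)] with i hi
    have h1 : (1 : ℂ) = inner ℂ (ξ i) (ξ i) := by
      rw [inner_self_eq_norm_sq_to_K, hξ]
      simp
    rw [h1, ← inner_sub_right]
    refine (norm_inner_le_norm _ _).trans ?_
    rw [hξ, one_mul]
    exact (hξF i g (hi.1 (Finset.mem_singleton_self g))).le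

end AlmostInvariant

/-! ### The trivial character of the reduced group C⋆-algebra -/

section Character

/-- The multiplicative domain of a state. -/
noncomputable def PositiveLinearMap.multiplicativeDomain {B : Type*} [CStarAlgebra B] [PartialOrder B]
    [StarOrderedRing B] (χ : B →ₚ[ℂ] ℂ) (h1 : χ 1 = 1) : StarSubalgebra ℂ B where
  carrier := {T | ∀ X, χ (X * T) = χ X * χ T ∧ χ (T * X) = χ T * χ X}
  mul_mem' := fun {S T} hS hT X => by
    rw [(hS T).2, ← mul_assoc, (hT (X * S)).1, (hS X).1, mul_assoc S T X, (hS (T * X)).2, (hT X).2,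
      mul_assoc, mul_assoc]
    exact ⟨rfl, rfl⟩
  add_mem' := fun {S T} hS hT X => by
    rw [mul_add, add_mul, map_add, map_add, map_add, (hS X).1, (hT X).1, (hS X).2, (hT X).2,
      mul_add, add_mul]
    exact ⟨rfl, rfl⟩
  algebraMap_mem' := fun r X => by
    simp only [Algebra.algebraMap_eq_smul_one, mul_smul_comm, smul_mul_assoc, mul_one, one_mul,
      map_smul, h1, smul_eq_mul]
    exact ⟨mul_comm _ _, trivial⟩
  star_mem' := fun {T} hT X => by
    have h2 : X * star T = star (T * star X) := by rw [star_mul, star_star]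
    have h3 : star T * X = star (star X * T) := by rw [star_mul, star_star]
    rw [h2, h3, map_star, map_star, map_star, (hT _).1, (hT _).2, star_mul, star_mul, map_star,
      star_star]
    exact ⟨rfl, rfl⟩

theorem PositiveLinearMap.isClosed_multiplicativeDomain {B : Type*} [CStarAlgebra B]
    [PartialOrder B] [StarOrderedRing B] (χ : B →ₚ[ℂ] ℂ) (h1 : χ 1 = 1) :
    IsClosed (χ.multiplicativeDomain h1 : Set B) := by
  have hc : Continuous χ := map_continuous χ
  change IsClosed {T | ∀ X, χ (X * T) = χ X * χ T ∧ χ (T * X) = χ T * χ X}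
  simp only [Set.ofPred_forall]
  refine isClosed_iInter fun X => (isClosed_eq ?_ ?_).inter (isClosed_eq ?_ ?_) <;> fun_prop

/-- A state restricts to a ⋆-homomorphism on its multiplicative domain. -/
noncomputable def PositiveLinearMap.restrictMultiplicativeDomain {B : Type*} [CStarAlgebra B] [PartialOrder B]
    [StarOrderedRing B] (χ : B →ₚ[ℂ] ℂ) (h1 : χ 1 = 1) {D : StarSubalgebra ℂ B}
    (hD : D ≤ χ.multiplicativeDomain h1) : D →⋆ₐ[ℂ] ℂ where
  toFun T := χ T
  map_one' := h1
  map_mul' S T := (hD T.2 S).1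
  map_zero' := map_zero χ
  map_add' S T := map_add χ _ _
  commutes' r := by
    change χ (algebraMap ℂ B r) = r
    rw [Algebra.algebraMap_eq_smul_one, map_smul, h1, smul_eq_mul, mul_one]
  map_star' T := map_star χ (T : B)

variable {Γ : Type u} [Group Γ]

/-- In the GNS space of `χ`, `‖λ_g - 1‖² = 1 - 1 - 1 + 1 = 0`. So `χ` does not distinguish `λ_g`
from `1` as a factor, and the multiplicative domain, being a closed ⋆-subalgebra, contains
`C*_r(Γ)`. -/
theorem IsAmenableGroup.exists_character (h : IsAmenableGroup Γ) :
    Nonempty (reducedGroupCStarAlgebra Γ →⋆ₐ[ℂ] ℂ) := by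
  obtain ⟨χ, h1, hχ⟩ := h.exists_state
  have hg : ∀ g, χ.gnsMap (leftRegular Γ g) = χ.gnsMap 1 := by
    intro g
    rw [← sub_eq_zero, ← map_sub, ← inner_self_eq_zero (𝕜 := ℂ),
      PositiveLinearMap.inner_gnsMap]
    have : star (leftRegular Γ g - 1) * (leftRegular Γ g - 1) =
        1 - leftRegular Γ g⁻¹ - leftRegular Γ g + 1 := by
      rw [star_sub, star_one, star_leftRegular, sub_mul, mul_sub, ← leftRegular_mul,
        inv_mul_cancel, leftRegular_one]
      simp only [mul_one, one_mul]
      abel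
    rw [this, map_add, map_sub, map_sub, h1, hχ, hχ]
    ring
  have hle : reducedGroupCStarAlgebra Γ ≤ χ.multiplicativeDomain h1 := by
    refine StarSubalgebra.topologicalClosure_minimal (StarAlgebra.adjoin_le ?_)
      (χ.isClosed_multiplicativeDomain h1)
    rintro _ ⟨g, rfl⟩ X
    rw [hχ, mul_one, one_mul]
    constructor
    · have := χ.inner_gnsMap (star X) (leftRegular Γ g)
      rw [star_star] at this
      rw [← this, hg, PositiveLinearMap.inner_gnsMap, star_star, mul_one]
    · have := χ.inner_gnsMap (leftRegular Γ g⁻¹) X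
      rw [star_leftRegular, inv_inv] at this
      rw [← this, hg, PositiveLinearMap.inner_gnsMap, star_one, one_mul]
  exact ⟨χ.restrictMultiplicativeDomain h1 hle⟩

end Character

/-! ### The weak expectation property of the complex numbers -/

section VectorState

variable {H : Type*} [NormedAddCommGroup H] [InnerProductSpace ℂ H] [CompleteSpace H]

theorem CStarMatrix.nonneg_of_posSemidef {n : Type*} [Fintype n] {G : Matrix n n ℂ}
    (hG : G.PosSemidef) :
    0 ≤ (CStarMatrix.ofMatrix fun i j => G i j • (1 : H →L[ℂ] H) :
      CStarMatrix n n (H →L[ℂ] H)) := by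
  classical
  obtain ⟨C, rfl⟩ : ∃ C : Matrix n n ℂ, G = C.conjTranspose * C := by
    open scoped MatrixOrder in
    exact CStarAlgebra.nonneg_iff_eq_star_mul_self.1 hG.nonneg
  let N : CStarMatrix n n (H →L[ℂ] H) := CStarMatrix.ofMatrix fun i j => C i j • 1
  have hN : ∀ i j, N i j = C i j • 1 := fun i j => rfl
  have h : (CStarMatrix.ofMatrix fun i j => (C.conjTranspose * C) i j • (1 : H →L[ℂ] H) :
      CStarMatrix n n (H →L[ℂ] H)) = star N * N := by
    ext1 i j
    rw [CStarMatrix.star_mul_self_apply]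
    change (C.conjTranspose * C) i j • (1 : H →L[ℂ] H) = _
    rw [Matrix.mul_apply, Finset.sum_smul]
    refine Finset.sum_congr rfl fun k _ => ?_
    rw [hN, hN, star_smul, star_one, smul_mul_smul_comm, mul_one, Matrix.conjTranspose_apply]
  rw [h]
  exact star_mul_self_nonneg N

/-- The completely positive map `T ↦ ⟪ξ, T ξ⟫ • 1`. -/
noncomputable def vectorStateCP (ξ : H) : (H →L[ℂ] H) →CP (H →L[ℂ] H) where
  toFun T := inner ℂ ξ (T ξ) • 1
  map_add' S T := by
    rw [add_apply, inner_add_right, add_smul]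
  map_smul' c T := by
    rw [smul_apply, inner_smul_right, mul_smul, RingHom.id_apply]
  map_cstarMatrix_nonneg' k M hM := by
    rw [StarOrderedRing.nonneg_iff] at hM
    induction hM using AddSubmonoid.closure_induction with
    | mem M hM =>
      obtain ⟨N, rfl⟩ := hM
      have hG : (∑ l, Matrix.gram ℂ fun i => N l i ξ).PosSemidef :=
        Matrix.posSemidef_sum _ fun l _ => Matrix.posSemidef_gram ℂ _
      refine (CStarMatrix.nonneg_of_posSemidef hG).trans_eq ?_
      ext1 i j
      change (∑ l, Matrix.gram ℂ fun i => N l i ξ) i j • (1 : H →L[ℂ] H) =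
        inner ℂ ξ ((star N * N) i j ξ) • 1
      rw [CStarMatrix.star_mul_self_apply, inner_sum_star_mul_apply, Matrix.sum_apply]
      rfl
    | zero =>
      refine le_of_eq ?_
      ext1 i j
      change (0 : H →L[ℂ] H) = inner ℂ ξ ((0 : H →L[ℂ] H) ξ) • 1
      simp
    | add P Q _ _ hP hQ =>
      refine (add_nonneg hP hQ).trans_eq ?_
      ext1 i j
      change inner ℂ ξ (P i j ξ) • (1 : H →L[ℂ] H) + inner ℂ ξ (Q i j ξ) • 1 =
        inner ℂ ξ ((P i j + Q i j) ξ) • 1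
      rw [add_apply, inner_add_right, add_smul]

theorem vectorStateCP_apply (ξ : H) (T : H →L[ℂ] H) :
    vectorStateCP ξ T = inner ℂ ξ (T ξ) • 1 := rfl

/-- `PUnit → ℂ` is a copy of `ℂ` in the universe `v`. It acts by scalars on a nonzero space, so a
vector state times `1` is a weak expectation. -/
theorem hasWEP_punit : HasWEP (PUnit.{v + 1} → ℂ) := by
  intro H _ _ _ π hπ
  have hscalar : ∀ a, π a = a PUnit.unit • 1 := fun a => by
    have : a = a PUnit.unit • 1 := by
      ext x
      simp
    conv_lhs => rw [this, map_smul, map_one]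
  have hnt : Nontrivial H := by
    by_contra hH
    rw [not_nontrivial_iff_subsingleton] at hH
    exact one_ne_zero (hπ (Subsingleton.elim (π 1) (π 0)))
  obtain ⟨ξ, hξ⟩ := exists_norm_eq H zero_le_one
  have h1 : inner ℂ ξ ξ = (1 : ℂ) := by
    rw [inner_self_eq_norm_sq_to_K, hξ]
    simp
  refine ⟨vectorStateCP ξ, fun T W _ => ?_, ?_, fun a => ?_⟩
  · rw [vectorStateCP_apply, mul_smul_comm, smul_mul_assoc, mul_one, one_mul]
  · rw [vectorStateCP_apply, one_apply_eq_self, h1, one_smul]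
  · rw [vectorStateCP_apply, hscalar, smul_apply, one_apply_eq_self, inner_smul_right, h1, mul_one]

theorem isTracialState_punit :
    IsTracialState (LinearMap.proj PUnit.unit : (PUnit.{v + 1} → ℂ) →ₗ[ℂ] ℂ) where
  nonneg a := star_mul_self_nonneg (a PUnit.unit)
  map_one := rfl
  map_mul_comm a b := mul_comm (a PUnit.unit) (b PUnit.unit)

end VectorState

/-! ### The equivalence with amenability. -/

theorem mainTheorem11 (Γ : Type u) [Group Γ] :
    ((∃ (A : Type v) (_ : CStarAlgebra A), HasWEP A ∧
        (∃ τ : A →ₗ[ℂ] ℂ, IsTracialState τ) ∧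
        Nonempty (reducedGroupCStarAlgebra Γ →⋆ₐ[ℂ] A)) ↔
      IsAmenableGroup Γ) ∧
    ((∃ (A : Type v) (_ : CStarAlgebra A), TopologicalSpace.SeparableSpace A ∧ HasWEP A ∧
        (∃ τ : A →ₗ[ℂ] ℂ, IsTracialState τ) ∧
        Nonempty (reducedGroupCStarAlgebra Γ →⋆ₐ[ℂ] A)) ↔
      IsAmenableGroup Γ) := by
  have hchar : IsAmenableGroup Γ →
      Nonempty (reducedGroupCStarAlgebra Γ →⋆ₐ[ℂ] (PUnit.{v + 1} → ℂ)) := fun h =>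
    h.exists_character.map fun χ => (StarAlgHom.ofId ℂ (PUnit.{v + 1} → ℂ)).comp χ
  refine ⟨⟨?_, fun h => ?_⟩, ⟨?_, fun h => ?_⟩⟩
  · rintro ⟨A, _, hA, ⟨τ, hτ⟩, ⟨j⟩⟩
    exact isAmenableGroup_of_hasWEP hA hτ j
  · exact ⟨PUnit.{v + 1} → ℂ, inferInstance, hasWEP_punit, ⟨_, isTracialState_punit⟩, hchar h⟩
  · rintro ⟨A, _, -, hA, ⟨τ, hτ⟩, ⟨j⟩⟩
    exact isAmenableGroup_of_hasWEP hA hτ j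
  · exact ⟨PUnit.{v + 1} → ℂ, inferInstance, inferInstance, hasWEP_punit,
      ⟨_, isTracialState_punit⟩, hchar h⟩
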